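/- For $t\in\mathbb C$ with $4t^3+27\neq 0$ consider the simple elliptic hypersurface singularity of type $\tilde E_8$ at the origin of $$V_t:=\{(z_1,z_2,z_3)\in\mathbb C^3 : z_1^6+t\,z_1^4z_2+z_2^3+z_3^2=0\}.$$ Let $r,s\in\mathbb C$ satisfy $4r^3+27\neq 0$ and $4s^3+27\neq 0$. Then the germs of $V_r$ and $V_s$ at $0$ are biholomorphically equivalent if and only if $r^3=s^3$. Here the germs of $V_r$ and $V_s$ at $0$ are called biholomorphically equivalent if there is a biholomorphic map $\Phi:U\to U'$ between open neighbourhoods $U,U'$ of $0$ in $\mathbb C^3$ with $\Phi(0)=0$ and $\Phi(V_r\cap U)=V_s\cap U'$. -/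

import Mathlib

/-- The germs at the origin of two subsets `A`, `B` of `ℂ^m` are biholomorphically equivalent:
there is a biholomorphic map `Φ` from an open neighbourhood of `0` onto an open neighbourhood of
`0` with `Φ 0 = 0` that carries the part of `A` in its source exactly onto the part of `B` in its
target.  Holomorphic maps of several variables are the maps that are locally given by convergent
power series. -/
def BiholomorphicGermsAtZero {m : ℕ} (A B : Set (Fin m → ℂ)) : Prop :=
  ∃ Φ : OpenPartialHomeomorph (Fin m → ℂ) (Fin m → ℂ),
    0 ∈ Φ.source ∧ Φ 0 = 0 ∧
    AnalyticOnNhd ℂ Φ Φ.source ∧ AnalyticOnNhd ℂ Φ.symm Φ.target ∧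
    Φ '' (A ∩ Φ.source) = B ∩ Φ.target

/-- The hypersurface `V_t = {z₁⁶ + t z₁⁴ z₂ + z₂³ + z₃² = 0}` in `ℂ³`; the coordinates
`z₁, z₂, z₃` are `z 0, z 1, z 2`. -/
def hypersurfaceE8 (t : ℂ) : Set (Fin 3 → ℂ) :=
  {z | z 0 ^ 6 + t * z 0 ^ 4 * z 1 + z 1 ^ 3 + z 2 ^ 2 = 0}

open Filter Topology

/-! With weights 1, 2, 3 on the coordinates, each point `(x, y)` of the affine cubic `y² + x³ + r x
+ 1 = 0` gives a curve `τ ↦ (τ, x τ², y τ³)` in `V_r`. Its image under `Φ` satisfies the equation of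
`V_s`. The low orders in `τ` force the Jacobian of `Φ` at `0` to be upper triangular; order 6 gives
an affine-linear substitution between two cubics (`cube_eq_of_affine_substitution`), and comparing
coefficients yields `r³ = s³`. The converse rescales `z₂` by a cube root of unity. -/

/-- Expansion to third order of an analytic function along the weighted curves
`τ ↦ (τ, x τ², y τ³)`, with coefficients affine-linear in `x` and `y`. -/
theorem exists_weighted_expansion {F : (Fin 3 → ℂ) → ℂ} (hF : AnalyticAt ℂ F 0) (h0 : F 0 = 0) :
    ∃ q c k : ℂ, ∀ x y : ℂ, ∃ R : ℂ → ℂ,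
      Tendsto R (𝓝[≠] 0) (𝓝 (fderiv ℂ F 0 (Pi.single 2 1) * y + c * x + k)) ∧
      ∀ τ ≠ 0, F ![τ, x * τ ^ 2, y * τ ^ 3] =
        fderiv ℂ F 0 (Pi.single 0 1) * τ + (fderiv ℂ F 0 (Pi.single 1 1) * x + q) * τ ^ 2
          + R τ * τ ^ 3 := by
  obtain ⟨p, hp⟩ := hF
  set L := fderiv ℂ F 0 with hL
  set h : (Fin 3 → ℂ) → ℂ := fun u => p 2 fun _ => u with hh
  set g : (Fin 3 → ℂ) → ℂ := fun u => p 3 fun _ => u with hg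
  have hhd : Differentiable ℂ h := by
    have : ContDiff ℂ 1 h := (p 2).contDiff.comp (contDiff_pi.2 fun _ => contDiff_id)
    exact this.differentiable one_ne_zero
  have hgc : Continuous g := (p 3).cont.comp (continuous_pi fun _ => continuous_id)
  set e : Fin 3 → ℂ := Pi.single 0 1 with he
  -- The curve is `τ • u τ` with `u 0 = e`, so the quadratic part of `F` contributes `τ² h (u τ)`:
  -- its value at `e` enters at order 2, its derivative along `u' 0` at order 3.
  refine ⟨h e, fderiv ℂ h e (Pi.single 1 1), g e, fun x y => ?_⟩
  set u : ℂ → Fin 3 → ℂ := fun τ => ![1, x * τ, y * τ ^ 2] with hu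
  have hu0 : u 0 = e := by
    ext i; fin_cases i <;> simp [hu, he]
  have hzu : ∀ τ, ![τ, x * τ ^ 2, y * τ ^ 3] = τ • u τ := by
    intro τ; ext i; fin_cases i <;> simp [hu] <;> ring
  have hud : HasDerivAt u (x • Pi.single 1 1) 0 := by
    rw [hasDerivAt_pi]
    intro i
    fin_cases i
    · simpa [hu] using hasDerivAt_const (0 : ℂ) (1 : ℂ)
    · simpa [hu] using (hasDerivAt_id (0 : ℂ)).const_mul x
    · simpa [hu] using ((hasDerivAt_id (0 : ℂ)).pow 2).const_mul y
  have huc : Tendsto u (𝓝[≠] 0) (𝓝 e) := by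
    rw [← hu0]; exact hud.continuousAt.tendsto.mono_left nhdsWithin_le_nhds
  have hD : Tendsto (fun τ => τ⁻¹ * (h (u τ) - h e)) (𝓝[≠] 0)
      (𝓝 (fderiv ℂ h e (Pi.single 1 1) * x)) := by
    have := ((hu0 ▸ (hhd (u 0)).hasFDerivAt :
      HasFDerivAt h (fderiv ℂ h e) (u 0)).comp_hasDerivAt 0 hud).tendsto_slope_zero
    simpa [hu0, mul_comm] using this
  have hz : Tendsto (fun τ => τ • u τ) (𝓝[≠] 0) (𝓝 0) := by
    have : Tendsto (fun τ : ℂ => τ) (𝓝[≠] 0) (𝓝 0) := nhdsWithin_le_nhds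
    simpa using this.smul huc
  have hO : Tendsto (fun τ => (τ ^ 3)⁻¹ * (F (τ • u τ) - p.partialSum 4 (τ • u τ))) (𝓝[≠] 0)
      (𝓝 0) := by
    have h1 := (hp.isBigO_sub_partialSum_pow 4).comp_tendsto hz
    have h2 : (fun τ : ℂ => ‖τ • u τ‖ ^ 4) =O[𝓝[≠] 0] fun τ => τ ^ 4 := by
      have : (fun τ : ℂ => τ • u τ) =O[𝓝[≠] 0] fun τ => τ := by
        simpa using (Asymptotics.isBigO_refl (fun τ : ℂ => τ) (𝓝[≠] 0)).smul (huc.isBigO_one ℂ)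
      exact this.norm_left.pow 4
    have h3 := (Asymptotics.isBigO_refl (fun τ : ℂ => (τ ^ 3)⁻¹) (𝓝[≠] 0)).mul (h1.trans h2)
    have h4 : (fun τ : ℂ => (τ ^ 3)⁻¹ * τ ^ 4) =ᶠ[𝓝[≠] 0] fun τ => τ := by
      filter_upwards [self_mem_nhdsWithin] with τ hτ
      have : τ ≠ 0 := hτ
      field_simp
    have h5 := (h3.trans_eventuallyEq h4).trans_tendsto nhdsWithin_le_nhds
    simpa [Function.comp_def] using h5
  have hp1 : ∀ v, (p 1 fun _ => v) = L v := by
    intro v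
    rw [hL, hp.hasFDerivAt.fderiv]
    simp [continuousMultilinearCurryFin1_apply]
    congr 1
    ext i j; fin_cases i; simp
  have hLu : ∀ τ, L (u τ) = L e + x * τ * L (Pi.single 1 1) + y * τ ^ 2 * L (Pi.single 2 1) := by
    intro τ
    have : u τ = e + (x * τ) • Pi.single 1 1 + (y * τ ^ 2) • Pi.single 2 1 := by
      ext i; fin_cases i <;> simp [hu, he]
    simp [this]
  have hps : ∀ τ, p.partialSum 4 (τ • u τ) =
      τ * L (u τ) + τ ^ 2 * h (u τ) + τ ^ 3 * g (u τ) := by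
    intro τ
    have hm : ∀ n : ℕ, (p n fun _ => τ • u τ) = τ ^ n * p n fun _ => u τ := by
      intro n
      simpa using (p n).map_smul_univ (fun _ => τ) (fun _ => u τ)
    have hz0 : (p 0 fun _ => τ • u τ) = 0 := by
      rw [← h0]; exact hp.coeff_zero _
    simp only [FormalMultilinearSeries.partialSum, Finset.sum_range_succ, Finset.sum_range_zero,
      hz0, hm 1, hm 2, hm 3, hp1]
    simp [hh, hg]
  refine ⟨fun τ => L (Pi.single 2 1) * y + τ⁻¹ * (h (u τ) - h e) + g (u τ) +
    (τ ^ 3)⁻¹ * (F (τ • u τ) - p.partialSum 4 (τ • u τ)), ?_, ?_⟩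
  · simpa using ((hD.const_add (L (Pi.single 2 1) * y)).add
      ((hgc.tendsto e).comp huc)).add hO
  · intro τ hτ
    beta_reduce
    rw [hzu, hps, hLu]
    field_simp
    ring

/-- The differential of a biholomorphic map is invertible. -/
theorem det_fderiv_ne_zero {Φ : OpenPartialHomeomorph (Fin 3 → ℂ) (Fin 3 → ℂ)}
    (h0 : 0 ∈ Φ.source) (hΦ : DifferentiableAt ℂ Φ 0) (hΨ : DifferentiableAt ℂ Φ.symm (Φ 0)) :
    (LinearMap.toMatrix' (fderiv ℂ Φ 0 : (Fin 3 → ℂ) →ₗ[ℂ] (Fin 3 → ℂ))).det ≠ 0 := by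
  have h1 := hΨ.hasFDerivAt.comp 0 hΦ.hasFDerivAt
  have h2 : HasFDerivAt (Φ.symm ∘ Φ) (ContinuousLinearMap.id ℂ (Fin 3 → ℂ)) 0 :=
    (hasFDerivAt_id _).congr_of_eventuallyEq (Φ.eventually_left_inverse h0)
  have h3 := congrArg (fun T : (Fin 3 → ℂ) →L[ℂ] (Fin 3 → ℂ) =>
    (LinearMap.toMatrix' (T : (Fin 3 → ℂ) →ₗ[ℂ] (Fin 3 → ℂ))).det) (h1.unique h2)
  simp only [ContinuousLinearMap.toLinearMap_comp, LinearMap.toMatrix'_comp, Matrix.det_mul,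
    ContinuousLinearMap.coe_id, LinearMap.toMatrix'_id, Matrix.det_one] at h3
  exact right_ne_zero_of_mul_eq_one h3

/-- Order-by-order consequences of an identity `A⁶ + s A⁴ B + B³ + C² = 0` between functions
with prescribed leading behaviour at `0`. -/
theorem weighted_leading_coefficients {s a b₁ b c₁ c₂ c : ℂ} {A B C : ℂ → ℂ}
    (hA : Tendsto A (𝓝[≠] 0) (𝓝 a)) (hB : Tendsto B (𝓝[≠] 0) (𝓝 b))
    (hC : Tendsto C (𝓝[≠] 0) (𝓝 c))
    (h : ∀ᶠ τ in 𝓝[≠] (0 : ℂ), (A τ * τ) ^ 6 + s * (A τ * τ) ^ 4 * (b₁ * τ + B τ * τ ^ 2)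
      + (b₁ * τ + B τ * τ ^ 2) ^ 3 + (c₁ * τ + c₂ * τ ^ 2 + C τ * τ ^ 3) ^ 2 = 0) :
    c₁ = 0 ∧ b₁ = 0 ∧ c₂ = 0 ∧ a ^ 6 + s * a ^ 4 * b + b ^ 3 + c ^ 2 = 0 := by
  have ht : Tendsto (fun τ : ℂ => τ) (𝓝[≠] 0) (𝓝 0) := nhdsWithin_le_nhds
  -- `G` is the left side divided by `τ ^ n`; it vanishes for small `τ ≠ 0`, hence in the limit.
  have key : ∀ (n : ℕ) (G : ℂ × ℂ × ℂ × ℂ → ℂ), Continuous G →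
      (∀ τ : ℂ, τ ^ n * G (τ, A τ, B τ, C τ) = (A τ * τ) ^ 6
        + s * (A τ * τ) ^ 4 * (b₁ * τ + B τ * τ ^ 2)
        + (b₁ * τ + B τ * τ ^ 2) ^ 3 + (c₁ * τ + c₂ * τ ^ 2 + C τ * τ ^ 3) ^ 2) →
      G (0, a, b, c) = 0 := by
    intro n G hG hGe
    have h1 : Tendsto (fun τ => G (τ, A τ, B τ, C τ)) (𝓝[≠] 0) (𝓝 (G (0, a, b, c))) :=
      (hG.tendsto _).comp (ht.prodMk_nhds (hA.prodMk_nhds (hB.prodMk_nhds hC)))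
    have h2 : (fun τ => G (τ, A τ, B τ, C τ)) =ᶠ[𝓝[≠] 0] fun _ => 0 := by
      filter_upwards [h, self_mem_nhdsWithin] with τ hτ hne
      rw [← hGe] at hτ
      exact (mul_eq_zero.1 hτ).resolve_left (pow_ne_zero _ hne)
    exact tendsto_nhds_unique (h1.congr' h2) tendsto_const_nhds
  have hc₁ : c₁ = 0 := by
    have := key 2 (fun v => v.1 ^ 4 * v.2.1 ^ 6 + s * v.1 ^ 3 * v.2.1 ^ 4 * (b₁ + v.2.2.1 * v.1)
      + v.1 * (b₁ + v.2.2.1 * v.1) ^ 3 + (c₁ + c₂ * v.1 + v.2.2.2 * v.1 ^ 2) ^ 2)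
      (by fun_prop) (fun τ => by ring)
    simpa using this
  subst hc₁
  have hb₁ : b₁ = 0 := by
    have := key 3 (fun v => v.1 ^ 3 * v.2.1 ^ 6 + s * v.1 ^ 2 * v.2.1 ^ 4 * (b₁ + v.2.2.1 * v.1)
      + (b₁ + v.2.2.1 * v.1) ^ 3 + v.1 * (c₂ + v.2.2.2 * v.1) ^ 2)
      (by fun_prop) (fun τ => by ring)
    simpa using this
  subst hb₁
  have hc₂ : c₂ = 0 := by
    have := key 4 (fun v => v.1 ^ 2 * v.2.1 ^ 6 + s * v.1 ^ 2 * v.2.1 ^ 4 * v.2.2.1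
      + v.1 ^ 2 * v.2.2.1 ^ 3 + (c₂ + v.2.2.2 * v.1) ^ 2)
      (by fun_prop) (fun τ => by ring)
    simpa using this
  subst hc₂
  exact ⟨rfl, rfl, rfl, key 6 (fun v => v.2.1 ^ 6 + s * v.2.1 ^ 4 * v.2.2.1
      + v.2.2.1 ^ 3 + v.2.2.2 ^ 2) (by fun_prop) (fun τ => by ring)⟩

theorem exists_point_on_cubic (r x : ℂ) : ∃ y : ℂ, y ^ 2 + x ^ 3 + r * x + 1 = 0 := by
  obtain ⟨y, hy⟩ := IsAlgClosed.exists_pow_nat_eq (-(x ^ 3 + r * x + 1)) two_pos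
  exact ⟨y, by linear_combination hy⟩

/-- Affine-linear substitutions carrying the curve `y² + x³ + r x + 1 = 0` into
`a⁶ + s a⁴ X + X³ + Y² = 0` exist only if `r³ = s³`. -/
theorem cube_eq_of_affine_substitution {r s a b q c d k : ℂ} (ha : a ≠ 0) (hc : c ≠ 0)
    (h : ∀ x y : ℂ, y ^ 2 + x ^ 3 + r * x + 1 = 0 →
      a ^ 6 + s * a ^ 4 * (b * x + q) + (b * x + q) ^ 3 + (c * y + d * x + k) ^ 2 = 0) :
    r ^ 3 = s ^ 3 := by
  -- The curve is symmetric under `y ↦ -y`, which isolates the cross term; a further factor `y`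
  -- turns it into a polynomial in `x`.
  have hodd : ∀ x : ℂ, (d * x + k) * (x ^ 3 + r * x + 1) = 0 := by
    intro x
    obtain ⟨y, hy⟩ := exists_point_on_cubic r x
    have h1 := h x y hy
    have h2 := h x (-y) (by linear_combination hy)
    have h3 : c * (y * (d * x + k)) = 0 := by linear_combination (h1 - h2) / 4
    have h4 := (mul_eq_zero.1 h3).resolve_left hc
    linear_combination -y * h4 + (d * x + k) * hy
  -- The fourth difference of a quartic is 24 times its leading coefficient.
  have hd : d = 0 := by
    linear_combination (hodd 2 - 4 * hodd 1 + 6 * hodd 0 - 4 * hodd (-1) + hodd (-2)) / 24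
  have hk : k = 0 := by
    have := hodd 0
    simpa using this
  subst hd hk
  have heven : ∀ x : ℂ, a ^ 6 + s * a ^ 4 * (b * x + q) + (b * x + q) ^ 3
      - c ^ 2 * (x ^ 3 + r * x + 1) = 0 := by
    intro x
    obtain ⟨y, hy⟩ := exists_point_on_cubic r x
    linear_combination h x y hy - c ^ 2 * hy
  have e3 : b ^ 3 = c ^ 2 := by
    linear_combination (heven 2 - 2 * heven 1 + 2 * heven (-1) - heven (-2)) / 12
  have hb : b ≠ 0 := by
    rintro rfl
    exact hc (by simpa using e3.symm)
  have e2 : b ^ 2 * q = 0 := by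
    linear_combination (heven 1 - 2 * heven 0 + heven (-1)) / 6
  have hq : q = 0 := (mul_eq_zero.1 e2).resolve_left (pow_ne_zero 2 hb)
  subst hq
  have e0 : a ^ 6 = c ^ 2 := by linear_combination heven 0
  have e1 : a ^ 4 * (s * b - r * a ^ 2) = 0 := by
    linear_combination (heven 1 - heven (-1)) / 2 - e3 - r * e0
  have e4 : s * b = r * a ^ 2 :=
    sub_eq_zero.1 ((mul_eq_zero.1 e1).resolve_left (pow_ne_zero 4 ha))
  have e5 : a ^ 6 * (r ^ 3 - s ^ 3) = 0 := by
    have h3 : (s * b) ^ 3 = (r * a ^ 2) ^ 3 := by rw [e4]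
    linear_combination -h3 + s ^ 3 * (e3 - e0)
  exact sub_eq_zero.1 ((mul_eq_zero.1 e5).resolve_left (pow_ne_zero 6 ha))

theorem cube_eq_of_biholomorphicGermsAtZero {r s : ℂ}
    (h : BiholomorphicGermsAtZero (hypersurfaceE8 r) (hypersurfaceE8 s)) : r ^ 3 = s ^ 3 := by
  obtain ⟨Φ, h0, hΦ0, hΦ, hΨ, hV⟩ := h
  have hdiff : DifferentiableAt ℂ Φ 0 := (hΦ 0 h0).differentiableAt
  have hdet := det_fderiv_ne_zero h0 hdiff (hΨ _ (Φ.map_source h0)).differentiableAt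
  have han : ∀ i, AnalyticAt ℂ (fun z => Φ z i) 0 := fun i =>
    (analyticAt_pi_iff.1 (hΦ 0 h0)) i
  have hent : ∀ i v, fderiv ℂ (fun z => Φ z i) 0 v = fderiv ℂ Φ 0 v i := by
    intro i v
    rw [((hasFDerivAt_pi'.1 hdiff.hasFDerivAt) i).fderiv]
    rfl
  have hz : ∀ i, Φ 0 i = 0 := fun i => by simp [hΦ0]
  obtain ⟨qA, dA, kA, hA⟩ := exists_weighted_expansion (han 0) (hz 0)
  obtain ⟨qB, dB, kB, hB⟩ := exists_weighted_expansion (han 1) (hz 1)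
  obtain ⟨qC, dC, kC, hC⟩ := exists_weighted_expansion (han 2) (hz 2)
  simp only [hent] at hA hB hC
  have htau : Tendsto (fun τ : ℂ => τ) (𝓝[≠] 0) (𝓝 0) := nhdsWithin_le_nhds
  have key : ∀ x y : ℂ, y ^ 2 + x ^ 3 + r * x + 1 = 0 →
      fderiv ℂ Φ 0 (Pi.single 0 1) 2 = 0 ∧ fderiv ℂ Φ 0 (Pi.single 0 1) 1 = 0 ∧
      fderiv ℂ Φ 0 (Pi.single 1 1) 2 * x + qC = 0 ∧
      fderiv ℂ Φ 0 (Pi.single 0 1) 0 ^ 6 + s * fderiv ℂ Φ 0 (Pi.single 0 1) 0 ^ 4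
        * (fderiv ℂ Φ 0 (Pi.single 1 1) 1 * x + qB)
        + (fderiv ℂ Φ 0 (Pi.single 1 1) 1 * x + qB) ^ 3
        + (fderiv ℂ Φ 0 (Pi.single 2 1) 2 * y + dC * x + kC) ^ 2 = 0 := by
    intro x y hxy
    obtain ⟨RA, hRA, hAe⟩ := hA x y
    obtain ⟨RB, hRB, hBe⟩ := hB x y
    obtain ⟨RC, hRC, hCe⟩ := hC x y
    have hA' : Tendsto (fun τ => fderiv ℂ Φ 0 (Pi.single 0 1) 0
        + (fderiv ℂ Φ 0 (Pi.single 1 1) 0 * x + qA) * τ + RA τ * τ ^ 2) (𝓝[≠] 0)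
        (𝓝 (fderiv ℂ Φ 0 (Pi.single 0 1) 0)) := by
      simpa using ((htau.const_mul (fderiv ℂ Φ 0 (Pi.single 1 1) 0 * x + qA)).const_add
        (fderiv ℂ Φ 0 (Pi.single 0 1) 0)).add (hRA.mul (htau.pow 2))
    have hB' : Tendsto (fun τ => (fderiv ℂ Φ 0 (Pi.single 1 1) 1 * x + qB) + RB τ * τ) (𝓝[≠] 0)
        (𝓝 (fderiv ℂ Φ 0 (Pi.single 1 1) 1 * x + qB)) := by
      simpa using (hRB.mul htau).const_add (fderiv ℂ Φ 0 (Pi.single 1 1) 1 * x + qB)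
    refine weighted_leading_coefficients hA' hB' hRC ?_
    have hcurve : Tendsto (fun τ : ℂ => ![τ, x * τ ^ 2, y * τ ^ 3]) (𝓝[≠] 0) (𝓝 0) := by
      have hc : Continuous fun τ : ℂ => ![τ, x * τ ^ 2, y * τ ^ 3] := by fun_prop
      have := hc.tendsto 0
      have hv : ![(0 : ℂ), x * 0 ^ 2, y * 0 ^ 3] = 0 := by
        ext i; fin_cases i <;> simp
      rw [hv] at this
      exact this.mono_left nhdsWithin_le_nhds
    filter_upwards [hcurve.eventually (Φ.open_source.mem_nhds h0), self_mem_nhdsWithin]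
      with τ hτ hne
    have hmem : ![τ, x * τ ^ 2, y * τ ^ 3] ∈ hypersurfaceE8 r := by
      simp only [hypersurfaceE8, Set.mem_ofPred_eq, Matrix.cons_val]
      linear_combination τ ^ 6 * hxy
    have himg : Φ ![τ, x * τ ^ 2, y * τ ^ 3] ∈ hypersurfaceE8 s :=
      (hV ▸ Set.mem_image_of_mem Φ ⟨hmem, hτ⟩ : _ ∈ hypersurfaceE8 s ∩ Φ.target).1
    simp only [hypersurfaceE8, Set.mem_ofPred_eq, hAe τ hne, hBe τ hne, hCe τ hne] at himg
    linear_combination himg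
  obtain ⟨y₀, hy₀⟩ := exists_point_on_cubic r 0
  obtain ⟨y₁, hy₁⟩ := exists_point_on_cubic r 1
  obtain ⟨h20, h10, hq, -⟩ := key 0 y₀ hy₀
  have h21 : fderiv ℂ Φ 0 (Pi.single 1 1) 2 = 0 := by
    linear_combination (key 1 y₁ hy₁).2.2.1 - hq
  -- All entries below the diagonal vanish, so the diagonal entries are nonzero.
  rw [Matrix.det_fin_three] at hdet
  simp only [LinearMap.toMatrix'_apply, ContinuousLinearMap.coe_coe, h20, h10, h21] at hdet
  refine cube_eq_of_affine_substitution (a := fderiv ℂ Φ 0 (Pi.single 0 1) 0)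
    (c := fderiv ℂ Φ 0 (Pi.single 2 1) 2) ?_ ?_ fun x y hxy => (key x y hxy).2.2.2
  · intro h; simp [h] at hdet
  · intro h; simp [h] at hdet

theorem biholomorphicGermsAtZero_of_cube_eq {r s : ℂ} (h : r ^ 3 = s ^ 3) :
    BiholomorphicGermsAtZero (hypersurfaceE8 r) (hypersurfaceE8 s) := by
  -- Here `a = r / s`, except that `s = 0` forces `r = 0` and `a = 1` serves.
  obtain ⟨a, ha, hs⟩ : ∃ a : ℂ, a ^ 3 = 1 ∧ s * a = r := by
    by_cases h0 : s = 0
    · subst h0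
      exact ⟨1, by simp, (by simpa using h : r = 0).symm ▸ by simp⟩
    · exact ⟨r / s, by rw [div_pow, h, div_self (pow_ne_zero 3 h0)], by field_simp⟩
  have ha0 : a ≠ 0 := by rintro rfl; simp at ha
  let e : (Fin 3 → ℂ) ≃L[ℂ] (Fin 3 → ℂ) := ContinuousLinearEquiv.piCongrRight
    ![ContinuousLinearEquiv.refl ℂ ℂ, ContinuousLinearEquiv.unitsEquivAut ℂ (Units.mk0 a ha0),
      ContinuousLinearEquiv.refl ℂ ℂ]
  have e0 : ∀ z, e z 0 = z 0 := fun z => rfl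
  have e1 : ∀ z, e z 1 = z 1 * a := fun z => rfl
  have e2 : ∀ z, e z 2 = z 2 := fun z => rfl
  have hmem : ∀ z, e z ∈ hypersurfaceE8 s ↔ z ∈ hypersurfaceE8 r := by
    intro z
    simp only [hypersurfaceE8, Set.mem_ofPred_eq, e0, e1, e2]
    rw [← hs]
    have : z 0 ^ 6 + s * z 0 ^ 4 * (z 1 * a) + (z 1 * a) ^ 3 + z 2 ^ 2 =
        z 0 ^ 6 + s * a * z 0 ^ 4 * z 1 + z 1 ^ 3 + z 2 ^ 2 := by
      linear_combination z 1 ^ 3 * ha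
    rw [this]
  refine ⟨e.toHomeomorph.toOpenPartialHomeomorph, by simp, by simp,
    fun z _ => (e : (Fin 3 → ℂ) →L[ℂ] (Fin 3 → ℂ)).analyticAt z,
    fun z _ => (e.symm : (Fin 3 → ℂ) →L[ℂ] (Fin 3 → ℂ)).analyticAt z, ?_⟩
  ext w
  constructor
  · rintro ⟨z, ⟨hz, -⟩, rfl⟩
    exact ⟨(hmem z).2 hz, by simp⟩
  · rintro ⟨hw, -⟩
    refine ⟨e.symm w, ⟨(hmem _).1 (by simpa using hw), by simp⟩, ?_⟩
    exact e.apply_symm_apply w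

theorem mainTheorem9 (r s : ℂ) (hr : 4 * r ^ 3 + 27 ≠ 0) (hs : 4 * s ^ 3 + 27 ≠ 0) :
    BiholomorphicGermsAtZero (hypersurfaceE8 r) (hypersurfaceE8 s) ↔ r ^ 3 = s ^ 3 :=
  ⟨cube_eq_of_biholomorphicGermsAtZero, biholomorphicGermsAtZero_of_cube_eq⟩
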